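/- Let $G$ be a discrete group. Let $C^*(G)$ be the full group C*-algebra of $G$ (the completion of $\mathbb{C}[G]$ for the supremum of the norms given by all unitary representations of $G$), let $U_G(t)\in C^*(G)$ be the unitary associated with $t\in G$, let $\lambda_G$ be the left regular representation of $G$ on $\ell_2(G)$, and let $M_G\subset B(\ell_2(G))$ be the von Neumann algebra generated by $\lambda_G$. Let $M_G\otimes_{\max}M_G$ be the completion of the algebraic tensor product for the maximal C*-norm. For $a\in M_G$ and $t\in G$ put $a(t)=\langle\delta_t,a\delta_e\rangle$, so that formally $a=\sum_{t\in G}a(t)\lambda_G(t)$. Then there exist a unital isometric $*$-homomorphism $$J_G: C^*(G)\to M_G\otimes_{\max}M_G,\qquad J_G(U_G(t))=\lambda_G(t)\otimes\lambda_G(t)\quad(t\in G),$$ and a completely contractive, completely positive linear map $$P_G: M_G\otimes_{\max}M_G\to C^*(G)$$ such that $P_GJ_G=\mathrm{Id}_{C^*(G)}$ and such that, for all $a,b\in M_G$, $$P_G(a\otimes b)=\sum_{t\in G}a(t)b(t)\,U_G(t),$$ where the series converges absolutely in $C^*(G)$. -/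

import Mathlib

open scoped TensorProduct

universe u

noncomputable section

/-! ### Enveloping C*-algebras -/

section Enveloping

variable (A : Type u) [Ring A] [StarRing A] [Algebra ℂ A]

/-- The values `‖π x‖`, where `π` runs over all unital `*`-representations of the `*`-algebra `A`
on complex Hilbert spaces. (Every such operator norm is a supremum over cyclic subrepresentations,
and these live in the universe of `A`.) -/
def repNorms (x : A) : Set ℝ :=
  {r | ∃ (H : Type u) (_ : NormedAddCommGroup H) (_ : InnerProductSpace ℂ H)
    (_ : CompleteSpace H) (π : A →⋆ₐ[ℂ] (H →L[ℂ] H)), ‖π x‖ = r}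

/-- A `*`-algebra on which the universal C*-seminorm is finite. -/
class HasBoundedReps : Prop where
  bddAbove_repNorms : ∀ x : A, BddAbove (repNorms A x)

/-- The universal C*-seminorm: the supremum of `‖π x‖` over all `*`-representations `π`. -/
def universalNorm (x : A) : ℝ := sSup (repNorms A x)

variable {A}

lemma repNorms_nonempty (x : A) : (repNorms A x).Nonempty := by
  let π : A →⋆ₐ[ℂ] (PUnit.{u + 1} →L[ℂ] PUnit.{u + 1}) :=
    { toFun := fun _ => 0
      map_one' := Subsingleton.elim _ _
      map_mul' := fun _ _ => Subsingleton.elim _ _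
      map_zero' := rfl
      map_add' := fun _ _ => Subsingleton.elim _ _
      commutes' := fun _ => Subsingleton.elim _ _
      map_star' := fun _ => Subsingleton.elim _ _ }
  exact ⟨_, PUnit, inferInstance, inferInstance, inferInstance, π, rfl⟩

lemma norm_rep_le_universalNorm [HasBoundedReps A] {H : Type u} [NormedAddCommGroup H]
    [InnerProductSpace ℂ H] [CompleteSpace H] (π : A →⋆ₐ[ℂ] (H →L[ℂ] H)) (x : A) :
    ‖π x‖ ≤ universalNorm A x :=
  le_csSup (HasBoundedReps.bddAbove_repNorms x) ⟨H, _, _, _, π, rfl⟩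

lemma universalNorm_le {x : A} {c : ℝ}
    (h : ∀ (H : Type u) [NormedAddCommGroup H] [InnerProductSpace ℂ H] [CompleteSpace H]
      (π : A →⋆ₐ[ℂ] (H →L[ℂ] H)), ‖π x‖ ≤ c) : universalNorm A x ≤ c := by
  refine csSup_le (repNorms_nonempty x) ?_
  rintro _ ⟨H, _, _, _, π, rfl⟩
  exact h H π

lemma universalNorm_nonneg (x : A) : 0 ≤ universalNorm A x := by
  refine Real.sSup_nonneg ?_
  rintro _ ⟨H, _, _, _, π, rfl⟩
  exact norm_nonneg _

variable (A)

/-- A copy of `A`, carrying the universal C*-seminorm. -/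
def PreEnvelope : Type u := A

instance : Ring (PreEnvelope A) := inferInstanceAs (Ring A)
instance : StarRing (PreEnvelope A) := inferInstanceAs (StarRing A)
instance : Algebra ℂ (PreEnvelope A) := inferInstanceAs (Algebra ℂ A)
instance [StarModule ℂ A] : StarModule ℂ (PreEnvelope A) := inferInstanceAs (StarModule ℂ A)

variable [HasBoundedReps A]

/-- The universal C*-seminorm as a seminorm on the additive group of `A`. -/
def universalSeminorm : AddGroupSeminorm (PreEnvelope A) where
  toFun x := universalNorm A x
  map_zero' := le_antisymm
    (universalNorm_le fun _ _ _ _ π => ((congrArg norm (map_zero π)).trans norm_zero).le)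
    (universalNorm_nonneg _)
  add_le' x y := universalNorm_le fun _ _ _ _ π =>
    (congrArg norm (map_add π x y)).le.trans <| (norm_add_le _ _).trans <|
      add_le_add (norm_rep_le_universalNorm π x) (norm_rep_le_universalNorm π y)
  neg' x := by
    have key : ∀ x : A, universalNorm A (-x) ≤ universalNorm A x := fun x =>
      universalNorm_le fun H _ _ _ π => by
        rw [map_neg, norm_neg]; exact norm_rep_le_universalNorm π x
    exact le_antisymm (key x) ((congrArg (universalNorm A) (neg_neg (x : A))).ge.trans (key (-x : A)))

instance : SeminormedRing (PreEnvelope A) where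
  __ := (universalSeminorm A).toSeminormedAddCommGroup
  __ := (inferInstance : Ring (PreEnvelope A))
  norm_mul_le x y := universalNorm_le fun _ _ _ _ π =>
    (congrArg norm (map_mul π x y)).le.trans <| (norm_mul_le _ _).trans <|
      mul_le_mul (norm_rep_le_universalNorm π x) (norm_rep_le_universalNorm π y)
        (norm_nonneg _) (universalNorm_nonneg _)

lemma PreEnvelope.norm_def (x : PreEnvelope A) : ‖x‖ = universalNorm A x := rfl

instance : NormedAlgebra ℂ (PreEnvelope A) where
  norm_smul_le c x := universalNorm_le fun _ _ _ _ π =>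
    (congrArg norm (map_smul π c x)).le.trans <| (norm_smul_le _ _).trans <|
      mul_le_mul_of_nonneg_left (norm_rep_le_universalNorm π x) (norm_nonneg _)

instance : NormedStarGroup (PreEnvelope A) where
  norm_star_le x := universalNorm_le fun _ _ _ _ π => by
    have h : ∀ x : A, ‖π (star x)‖ = ‖π x‖ := fun x => by rw [map_star, norm_star]
    exact (h x).le.trans (norm_rep_le_universalNorm π x)

lemma PreEnvelope.norm_sq_le (x : PreEnvelope A) : ‖x‖ * ‖x‖ ≤ ‖star x * x‖ := by
  have h : ‖x‖ ≤ √‖star x * x‖ := universalNorm_le fun _ _ _ _ π => by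
    refine Real.le_sqrt_of_sq_le ?_
    have h : ∀ x : A, ‖π x‖ ^ 2 = ‖π (star x * x)‖ := fun x => by
      rw [map_mul, map_star, CStarRing.norm_star_mul_self, sq]
    exact (h x).le.trans (norm_rep_le_universalNorm π _)
  calc ‖x‖ * ‖x‖ ≤ √‖star x * x‖ * √‖star x * x‖ := by gcongr
    _ = ‖star x * x‖ := Real.mul_self_sqrt (norm_nonneg _)

/-- The enveloping C*-algebra of a `*`-algebra: the (Hausdorff) completion for the universal
C*-seminorm. -/
def CStarEnvelope : Type u := UniformSpace.Completion (PreEnvelope A)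

namespace CStarEnvelope

open UniformSpace

instance : NormedRing (CStarEnvelope A) :=
  inferInstanceAs (NormedRing (Completion (PreEnvelope A)))
instance : Algebra ℂ (CStarEnvelope A) :=
  inferInstanceAs (Algebra ℂ (Completion (PreEnvelope A)))
instance : NormedAlgebra ℂ (CStarEnvelope A) where
  norm_smul_le := norm_smul_le (α := ℂ) (β := Completion (PreEnvelope A))
instance : CompleteSpace (CStarEnvelope A) :=
  inferInstanceAs (CompleteSpace (Completion (PreEnvelope A)))

/-- The canonical map with dense range from `A` to its enveloping C*-algebra. -/
def coe : A → CStarEnvelope A := fun x => ((show PreEnvelope A from x : PreEnvelope A) :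
  Completion (PreEnvelope A))

/-- The involution extends by continuity. -/
instance : Star (CStarEnvelope A) where
  star := Completion.map (star : PreEnvelope A → PreEnvelope A)

lemma uniformContinuous_star_pre :
    UniformContinuous (star : PreEnvelope A → PreEnvelope A) :=
  (starNormedAddGroupHom (E := PreEnvelope A)).uniformContinuous

variable {A}

lemma continuous_star' : Continuous (star : CStarEnvelope A → CStarEnvelope A) :=
  Completion.continuous_map

lemma continuous_mul' : Continuous fun p : CStarEnvelope A × CStarEnvelope A => p.1 * p.2 :=
  _root_.continuous_mul

lemma star_coe (x : A) : star (coe A x) = coe A (star x) :=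
  Completion.map_coe (uniformContinuous_star_pre A) _

lemma coe_mul (x y : A) : coe A (x * y) = coe A x * coe A y :=
  Completion.coe_mul (α := PreEnvelope A) x y

lemma coe_add (x y : A) : coe A (x + y) = coe A x + coe A y :=
  Completion.coe_add (α := PreEnvelope A) x y

lemma coe_smul (c : ℂ) (x : A) : coe A (c • x) = c • coe A x :=
  Completion.coe_smul (X := PreEnvelope A) c x

lemma norm_coe (x : A) : ‖coe A x‖ = universalNorm A x :=
  Completion.norm_coe (E := PreEnvelope A) x

lemma denseRange_coe : DenseRange (coe A) := Completion.denseRange_coe (α := PreEnvelope A)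

instance : StarRing (CStarEnvelope A) where
  star_involutive x := by
    refine denseRange_coe.induction_on x
      (isClosed_eq (continuous_star'.comp continuous_star') continuous_id) fun a => ?_
    rw [star_coe, star_coe, star_star]
  star_mul x y := by
    refine denseRange_coe.induction_on₂ (p := fun x y : CStarEnvelope A =>
      star (x * y) = star y * star x) ?_ (fun a b => ?_) x y
    · exact isClosed_eq (continuous_star'.comp continuous_mul')
        ((continuous_star'.comp continuous_snd).mul (continuous_star'.comp continuous_fst))
    · rw [star_coe, star_coe, ← coe_mul, ← coe_mul, star_coe, star_mul]
  star_add x y := by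
    refine denseRange_coe.induction_on₂ (p := fun x y : CStarEnvelope A =>
      star (x + y) = star x + star y) ?_ (fun a b => ?_) x y
    · exact isClosed_eq (continuous_star'.comp _root_.continuous_add)
        ((continuous_star'.comp continuous_fst).add (continuous_star'.comp continuous_snd))
    · rw [star_coe, star_coe, ← coe_add, ← coe_add, star_coe, star_add]

instance [StarModule ℂ A] : StarModule ℂ (CStarEnvelope A) where
  star_smul c x := by
    refine denseRange_coe.induction_on x
      (isClosed_eq (continuous_star'.comp (continuous_const_smul c))
        ((continuous_const_smul (star c)).comp continuous_star')) fun a => ?_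
    rw [star_coe, ← coe_smul, ← coe_smul, star_coe, star_smul]

instance : CStarRing (CStarEnvelope A) where
  norm_mul_self_le x := by
    refine denseRange_coe.induction_on x
      (isClosed_le (by fun_prop) ((continuous_star'.mul continuous_id).norm)) fun a => ?_
    rw [star_coe, ← coe_mul, norm_coe, norm_coe]
    exact PreEnvelope.norm_sq_le A a

variable [StarModule ℂ A]

instance : CStarAlgebra (CStarEnvelope A) where

/-- The usual order of a C*-algebra: `x ≤ y` iff `y - x` is positive. -/
instance : PartialOrder (CStarEnvelope A) := CStarAlgebra.spectralOrder _

instance : StarOrderedRing (CStarEnvelope A) := CStarAlgebra.spectralOrderedRing _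

variable (A) in
/-- The canonical `*`-homomorphism from `A` to its enveloping C*-algebra. -/
def of : A →⋆ₐ[ℂ] CStarEnvelope A where
  toFun := coe A
  map_one' := rfl
  map_mul' := coe_mul
  map_zero' := rfl
  map_add' := coe_add
  commutes' _ := rfl
  map_star' x := (star_coe x).symm

end CStarEnvelope

end Enveloping

/-! ### The maximal tensor product -/

section MaxTensor

variable (A B : Type u) [CStarAlgebra A] [CStarAlgebra B]

instance : HasBoundedReps (A ⊗[ℂ] B) where
  bddAbove_repNorms x := by
    induction x with
    | zero =>
      refine ⟨0, ?_⟩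
      rintro _ ⟨H, _, _, _, π, rfl⟩
      simp
    | tmul a b =>
      refine ⟨‖a‖ * ‖b‖, ?_⟩
      rintro _ ⟨H, _, _, _, π, rfl⟩
      let π₁ : A →⋆ₐ[ℂ] (H →L[ℂ] H) :=
        { (π : (A ⊗[ℂ] B) →ₐ[ℂ] (H →L[ℂ] H)).comp Algebra.TensorProduct.includeLeft with
          map_star' := fun a => by
            have : star (a ⊗ₜ[ℂ] (1 : B)) = star a ⊗ₜ[ℂ] 1 := by simp
            simpa [this] using map_star π (a ⊗ₜ[ℂ] (1 : B)) }
      let π₂ : B →⋆ₐ[ℂ] (H →L[ℂ] H) :=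
        { (π : (A ⊗[ℂ] B) →ₐ[ℂ] (H →L[ℂ] H)).comp Algebra.TensorProduct.includeRight with
          map_star' := fun b => by
            have : star ((1 : A) ⊗ₜ[ℂ] b) = 1 ⊗ₜ[ℂ] star b := by simp
            simpa [this] using map_star π ((1 : A) ⊗ₜ[ℂ] b) }
      have h : π (a ⊗ₜ[ℂ] b) = π₁ a * π₂ b := by
        change _ = π (a ⊗ₜ[ℂ] 1) * π (1 ⊗ₜ[ℂ] b)
        rw [← map_mul]; simp
      rw [h]
      exact (norm_mul_le _ _).trans (mul_le_mul (NonUnitalStarAlgHom.norm_apply_le π₁ a)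
        (NonUnitalStarAlgHom.norm_apply_le π₂ b) (norm_nonneg _) (norm_nonneg _))
    | add x y hx hy =>
      obtain ⟨c, hc⟩ := hx
      obtain ⟨d, hd⟩ := hy
      refine ⟨c + d, ?_⟩
      rintro _ ⟨H, _, _, _, π, rfl⟩
      rw [map_add]
      exact (norm_add_le _ _).trans
        (add_le_add (hc ⟨H, _, _, _, π, rfl⟩) (hd ⟨H, _, _, _, π, rfl⟩))

/-- The maximal tensor product of two unital C*-algebras: the completion of the algebraic tensor
product for the maximal C*-norm `‖x‖_max = sup ‖π x‖`, the supremum running over all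
`*`-representations `π` of the `*`-algebra `A ⊗ B` on Hilbert spaces (equivalently, over all pairs
of `*`-representations of `A` and `B` with commuting ranges). -/
abbrev MaxTensor : Type u := CStarEnvelope (A ⊗[ℂ] B)

variable {A B} in
/-- The elementary tensor `a ⊗ b` in the maximal tensor product. -/
def MaxTensor.tmul (a : A) (b : B) : MaxTensor A B := CStarEnvelope.of (A ⊗[ℂ] B) (a ⊗ₜ[ℂ] b)

end MaxTensor

/-! ### The full C*-algebra of a discrete group -/

section FullGroupCStar

variable (G : Type u) [Group G]

/-- The involution of the complex group algebra, `(star x)(t) = conj (x(t⁻¹))`. -/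
instance : Star (MonoidAlgebra ℂ G) where
  star x := .ofCoeff ((x.coeff.equivMapDomain (Equiv.inv G)).mapRange star (star_zero ℂ))

variable {G}

lemma MonoidAlgebra.coeff_star' (x : MonoidAlgebra ℂ G) (t : G) :
    (star x).coeff t = star (x.coeff t⁻¹) := rfl

lemma MonoidAlgebra.star_single' (t : G) (c : ℂ) :
    star (MonoidAlgebra.single t c) = MonoidAlgebra.single t⁻¹ (star c) := by
  ext s
  rw [MonoidAlgebra.coeff_star']
  by_cases h : t = s⁻¹
  · subst h; simp
  · have h' : t⁻¹ ≠ s := fun e => h (by simp [← e])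
    simp [h, h']

lemma MonoidAlgebra.star_add' (x y : MonoidAlgebra ℂ G) : star (x + y) = star x + star y := by
  ext s
  simp [MonoidAlgebra.coeff_star']

instance : StarRing (MonoidAlgebra ℂ G) where
  star_involutive x := by
    ext s
    simp [MonoidAlgebra.coeff_star']
  star_mul x y := by
    have h0 : star (0 : MonoidAlgebra ℂ G) = 0 := by ext s; simp [MonoidAlgebra.coeff_star']
    induction x using MonoidAlgebra.induction_linear with
    | zero => simp [h0]
    | add x x' hx hx' => rw [add_mul, MonoidAlgebra.star_add', MonoidAlgebra.star_add', hx, hx',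
        mul_add]
    | single s c =>
      induction y using MonoidAlgebra.induction_linear with
      | zero => simp [h0]
      | add y y' hy hy' => rw [mul_add, MonoidAlgebra.star_add', MonoidAlgebra.star_add', hy, hy',
          add_mul]
      | single t d => simp [MonoidAlgebra.star_single', MonoidAlgebra.single_mul_single, mul_comm]
  star_add := MonoidAlgebra.star_add'

instance : StarModule ℂ (MonoidAlgebra ℂ G) where
  star_smul c x := by
    ext s
    simp [MonoidAlgebra.coeff_star']

lemma norm_rep_single_le {H : Type u} [NormedAddCommGroup H] [InnerProductSpace ℂ H]
    [CompleteSpace H] (π : MonoidAlgebra ℂ G →⋆ₐ[ℂ] (H →L[ℂ] H)) (t : G) (c : ℂ) :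
    ‖π (MonoidAlgebra.single t c)‖ ≤ ‖c‖ := by
  set x := π (MonoidAlgebra.single t c) with hx
  have h1 : star x * x = (star c * c) • (1 : H →L[ℂ] H) := by
    rw [hx, ← map_star, ← map_mul, MonoidAlgebra.star_single', MonoidAlgebra.single_mul_single,
      inv_mul_cancel, ← map_one π, ← map_smul, MonoidAlgebra.one_def, MonoidAlgebra.smul_single]
    simp
  have h2 : ‖x‖ * ‖x‖ ≤ ‖c‖ * ‖c‖ := by
    rw [← CStarRing.norm_star_mul_self, h1]
    refine (norm_smul_le _ _).trans ?_
    rw [norm_mul, norm_star]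
    exact mul_le_of_le_one_right (by positivity) ContinuousLinearMap.norm_id_le
  exact abs_le_of_sq_le_sq' (by nlinarith) (norm_nonneg _) |>.2

instance : HasBoundedReps (MonoidAlgebra ℂ G) where
  bddAbove_repNorms x := by
    induction x using MonoidAlgebra.induction_linear with
    | zero =>
      refine ⟨0, ?_⟩
      rintro _ ⟨H, _, _, _, π, rfl⟩
      simp
    | single t c =>
      refine ⟨‖c‖, ?_⟩
      rintro _ ⟨H, _, _, _, π, rfl⟩
      exact norm_rep_single_le π t c
    | add x y hx hy =>
      obtain ⟨c, hc⟩ := hx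
      obtain ⟨d, hd⟩ := hy
      refine ⟨c + d, ?_⟩
      rintro _ ⟨H, _, _, _, π, rfl⟩
      rw [map_add]
      exact (norm_add_le _ _).trans
        (add_le_add (hc ⟨H, _, _, _, π, rfl⟩) (hd ⟨H, _, _, _, π, rfl⟩))

variable (G) in
/-- The full C*-algebra `C*(G)` of the discrete group `G`: the completion of the group algebra
`ℂ[G]` for the norm `‖x‖ = sup ‖π x‖`, the supremum running over all `*`-representations of `ℂ[G]`,
i.e. over the linear extensions of all unitary representations of `G`. -/
abbrev FullGroupCStar : Type u := CStarEnvelope (MonoidAlgebra ℂ G)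

/-- The element `U_G(t)` of `C*(G)`, i.e. the universal unitary representation of `G` at `t`. -/
def universalRep (t : G) : FullGroupCStar G :=
  CStarEnvelope.of (MonoidAlgebra ℂ G) (MonoidAlgebra.single t 1)

end FullGroupCStar

/-! ### The von Neumann algebra of a discrete group -/

section GroupVonNeumann

/-- The von Neumann algebra generated by a set `S` of operators: the double commutant of
`S ∪ star S`. -/
def vonNeumannGenerated {H : Type u} [NormedAddCommGroup H] [InnerProductSpace ℂ H]
    [CompleteSpace H] (S : Set (H →L[ℂ] H)) : VonNeumannAlgebra H where
  toStarSubalgebra :=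
    StarSubalgebra.centralizer ℂ (StarSubalgebra.centralizer ℂ S : Set (H →L[ℂ] H))
  centralizer_centralizer' := by simp

instance {H : Type u} [NormedAddCommGroup H] [InnerProductSpace ℂ H] [CompleteSpace H]
    (M : VonNeumannAlgebra H) : IsClosed (M.toStarSubalgebra : Set (H →L[ℂ] H)) := by
  rw [VonNeumannAlgebra.coe_toStarSubalgebra, ← M.centralizer_centralizer]
  exact Set.isClosed_centralizer _

lemma subset_vonNeumannGenerated {H : Type u} [NormedAddCommGroup H] [InnerProductSpace ℂ H]
    [CompleteSpace H] {S : Set (H →L[ℂ] H)} {x : H →L[ℂ] H} (hx : x ∈ S) :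
    x ∈ (vonNeumannGenerated S).toStarSubalgebra := by
  have h : ∀ y ∈ StarSubalgebra.centralizer ℂ S, x * y = y * x ∧ star x * y = y * star x :=
    fun y hy => (StarSubalgebra.mem_centralizer_iff ℂ).1 hy x hx
  refine (StarSubalgebra.mem_centralizer_iff ℂ).2 fun y hy => ⟨(h y hy).1.symm, ?_⟩
  exact (h _ (star_mem hy)).1.symm

variable (G : Type u) [Group G]

/-- The Hilbert space `ℓ₂(G)`. -/
abbrev EllTwo : Type u := lp (fun _ : G => ℂ) 2

variable {G}

open Classical in
/-- The canonical basis vector `δ_t` of `ℓ₂(G)`. -/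
def delta (t : G) : EllTwo G := lp.single 2 t (1 : ℂ)

/-- The left regular representation `λ_G`, `(λ_G(t) f)(s) = f(t⁻¹ s)`. -/
def leftRegular (t : G) : EllTwo G →L[ℂ] EllTwo G :=
  LinearIsometry.toContinuousLinearMap
    { toFun := fun f => ⟨fun s => f (t⁻¹ * s), memℓp_gen <| by
        have h := (lp.memℓp f).summable (by norm_num)
        exact (Equiv.mulLeft t⁻¹).summable_iff.2 h⟩
      map_add' := fun f g => rfl
      map_smul' := fun c f => rfl
      norm_map' := fun f => by
        rw [lp.norm_eq_tsum_rpow (by norm_num), lp.norm_eq_tsum_rpow (by norm_num)]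
        congr 1
        exact (Equiv.mulLeft t⁻¹).tsum_eq fun s => ‖f s‖ ^ (2 : ENNReal).toReal }

lemma leftRegular_apply (t : G) (f : EllTwo G) (s : G) : leftRegular t f s = f (t⁻¹ * s) := rfl

lemma leftRegular_delta (t s : G) : leftRegular t (delta s) = delta (t * s) := by
  classical
  ext r
  rw [leftRegular_apply, delta, delta, lp.single_apply, lp.single_apply, Pi.single_apply,
    Pi.single_apply]
  simp only [inv_mul_eq_iff_eq_mul]

variable (G) in
/-- The von Neumann algebra `M_G` generated by the left regular representation, as a C*-algebra. -/
abbrev GroupVN : Type u := (vonNeumannGenerated (Set.range (leftRegular (G := G)))).toStarSubalgebra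

/-- `λ_G(t)` as an element of `M_G`. -/
def regularUnitary (t : G) : GroupVN G := ⟨leftRegular t, subset_vonNeumannGenerated ⟨t, rfl⟩⟩

/-- The coefficient `a(t) = ⟨δ_t, a δ_e⟩` in the formal expansion `a = ∑ a(t) λ_G(t)` of
`a ∈ M_G`. -/
def groupCoeff (a : GroupVN G) (t : G) : ℂ :=
  inner ℂ (delta t) ((a : EllTwo G →L[ℂ] EllTwo G) (delta 1))

end GroupVonNeumann

/-! ### Complete contractivity -/

/-- A linear map between C*-algebras is completely contractive if all its amplifications
`[x_ij] ↦ [u(x_ij)]` to `n × n` matrices are contractions for the C*-norms on the matrix algebras,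
i.e. `‖u‖_cb ≤ 1`. -/
def IsCompletelyContractive {A B : Type u} [CStarAlgebra A] [PartialOrder A] [StarOrderedRing A]
    [CStarAlgebra B] [PartialOrder B] [StarOrderedRing B] (u : A →ₗ[ℂ] B) : Prop :=
  ∀ (n : ℕ) (x : CStarMatrix (Fin n) (Fin n) A), ‖x.map u‖ ≤ ‖x‖

end

/-!
The map `P_G` comes from Fell's absorption principle. Let `σ` be a unitary representation of `G` on
`H`. The unitary `ξ ↦ (s ↦ σ(s) ξ(s))` of `ℓ₂(G) ⊗ H` intertwines `λ ⊗ 1` with `λ ⊗ σ`, so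
`∑ a(t) λ(t) ↦ ∑ a(t) λ(t) ⊗ σ(t)` is a representation of `M_G` (`fellRep`). It commutes with the
representation `∑ b(t) λ(t) ↦ ∑ b(t) ρ(t) ⊗ 1` through the right regular representation `ρ`
(`rightRep`, `commute_fellRep_rightRep`), and the pair gives a representation of the maximal tensor
product (`pairRep`). Its compression to `δ_e ⊗ H` sends `a ⊗ b` to `∑ a(t) b(t) σ(t)`
(`hasSum_compression_pairRep`): the `δ_e`-coefficient of `(λ(t) ⊗ σ(t)) (ρ(s) ⊗ 1) (δ_e ⊗ h)` is
`σ(t) h` if `s = t`, and zero otherwise.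

So the map `a ⊗ b ↦ ∑ a(t) b(t) U_G(t)`, whose series converges absolutely because the coefficients
of `a` and `b` are square summable, becomes a compression of a `*`-representation in every
representation of `C*(G)`. All representations of `C*(G)` together detect the norm and the
positivity of matrices over `C*(G)`, whence the map is completely positive and completely
contractive (`completelyPositive_and_contractive_of_dilation`).

The homomorphism `J_G` is the extension of `t ↦ λ(t) ⊗ λ(t)` to `C*(G)`. Since the coefficients of
`λ(t)` are those of `δ_t`, `P_G` is a left inverse of `J_G`, so `J_G` is injective and therefore
isometric.
-/

noncomputable section

/-! ### Universal property of the enveloping C*-algebra -/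

namespace CStarEnvelope

variable {A : Type u} [Ring A] [StarRing A] [Algebra ℂ A] [HasBoundedReps A]

lemma norm_of (x : A) : ‖of A x‖ = universalNorm A x := norm_coe x

lemma denseRange_of : DenseRange (of A) := denseRange_coe

variable [StarModule ℂ A]

/-- A linear map on `A` dominated by the universal norm, extended to the enveloping C*-algebra. The
bound enters only in `extendLinear_of`; without it the value is junk. -/
def extendLinear {F : Type*} [NormedAddCommGroup F] [NormedSpace ℂ F] [CompleteSpace F]
    (f : A →ₗ[ℂ] F) : CStarEnvelope A →L[ℂ] F :=
  f.extendOfNorm (of A).toLinearMap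

lemma extendLinear_of {F : Type*} [NormedAddCommGroup F] [NormedSpace ℂ F] [CompleteSpace F]
    {f : A →ₗ[ℂ] F} (hf : ∀ x, ‖f x‖ ≤ universalNorm A x) (x : A) :
    extendLinear f (of A x) = f x :=
  LinearMap.extendOfNorm_eq (e := (of A).toLinearMap) denseRange_of
    ⟨1, fun x => by simpa [norm_of] using hf x⟩ x

/-- A `*`-homomorphism into a C*-algebra dominated by the universal norm extends to the enveloping
C*-algebra. -/
def lift {B : Type*} [CStarAlgebra B] (φ : A →⋆ₐ[ℂ] B) (hφ : ∀ x, ‖φ x‖ ≤ universalNorm A x) :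
    CStarEnvelope A →⋆ₐ[ℂ] B :=
  have key : ∀ x, extendLinear φ.toLinearMap (of A x) = φ x := extendLinear_of hφ
  { toFun := extendLinear φ.toLinearMap
    map_one' := by rw [← map_one (of A), key, map_one]
    map_zero' := map_zero _
    map_add' := map_add _
    map_mul' := fun x y => by
      refine denseRange_of.induction_on₂ (p := fun x y : CStarEnvelope A =>
        extendLinear φ.toLinearMap (x * y) =
          extendLinear φ.toLinearMap x * extendLinear φ.toLinearMap y) ?_ (fun a b => ?_) x y
      · exact isClosed_eq (by fun_prop) (by fun_prop)
      · rw [← map_mul, key, key, key, map_mul]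
    commutes' := fun c => by
      rw [Algebra.algebraMap_eq_smul_one, map_smul, ← map_one (of A), key, map_one,
        Algebra.algebraMap_eq_smul_one]
    map_star' := fun x => by
      refine denseRange_of.induction_on (p := fun x : CStarEnvelope A =>
        extendLinear φ.toLinearMap (star x) = star (extendLinear φ.toLinearMap x)) x ?_
        fun a => ?_
      · exact isClosed_eq (by fun_prop) (by fun_prop)
      · rw [← map_star, key, key, map_star] }

@[simp]
lemma lift_of {B : Type*} [CStarAlgebra B] (φ : A →⋆ₐ[ℂ] B)
    (hφ : ∀ x, ‖φ x‖ ≤ universalNorm A x) (x : A) : lift φ hφ (of A x) = φ x :=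
  extendLinear_of (f := φ.toLinearMap) hφ x

/-- The extension of a `*`-representation of `A` to the enveloping C*-algebra. -/
def liftRep {H : Type u} [NormedAddCommGroup H] [InnerProductSpace ℂ H] [CompleteSpace H]
    (π : A →⋆ₐ[ℂ] (H →L[ℂ] H)) : CStarEnvelope A →⋆ₐ[ℂ] (H →L[ℂ] H) :=
  lift π (norm_rep_le_universalNorm π)

@[simp]
lemma liftRep_of {H : Type u} [NormedAddCommGroup H] [InnerProductSpace ℂ H] [CompleteSpace H]
    (π : A →⋆ₐ[ℂ] (H →L[ℂ] H)) (x : A) : liftRep π (of A x) = π x :=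
  lift_of _ _ x

/-- The representations of `A` compute the norm of its enveloping C*-algebra, also on the elements
added by the completion. -/
lemma norm_le_of_forall_liftRep {y : CStarEnvelope A} {c : ℝ}
    (h : ∀ (H : Type u) [NormedAddCommGroup H] [InnerProductSpace ℂ H] [CompleteSpace H]
      (π : A →⋆ₐ[ℂ] (H →L[ℂ] H)), ‖liftRep π y‖ ≤ c) : ‖y‖ ≤ c := by
  refine le_of_forall_pos_le_add fun ε hε => ?_
  obtain ⟨x, hx⟩ := denseRange_of.exists_dist_lt y (half_pos hε)
  rw [dist_eq_norm] at hx
  have h1 : ‖of A x‖ ≤ c + ε / 2 := by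
    rw [norm_of]
    refine universalNorm_le fun H _ _ _ π => ?_
    rw [← liftRep_of π x, ← sub_sub_self y (of A x), map_sub]
    refine (norm_sub_le _ _).trans (add_le_add (h H π) ?_)
    exact (NonUnitalStarAlgHom.norm_apply_le (liftRep π) _).trans hx.le
  have h2 : ‖y‖ ≤ ‖y - of A x‖ + ‖of A x‖ := by simpa using norm_add_le (y - of A x) (of A x)
  linarith

end CStarEnvelope

/-! ### Jointly faithful families of `*`-homomorphisms -/

section JointlyFaithful

variable {B : Type*} [CStarAlgebra B] [PartialOrder B] [StarOrderedRing B]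
  {ι : Sort*} {C : ι → Type*} [∀ i, CStarAlgebra (C i)] [∀ i, PartialOrder (C i)]
  [∀ i, StarOrderedRing (C i)]

/-- A jointly injective family of `*`-homomorphisms detects positivity: the negative part of an
element with positive images is killed by the family. -/
lemma nonneg_of_forall_starAlgHom_nonneg (φ : ∀ i, B →⋆ₐ[ℂ] C i)
    (hφ : ∀ x, (∀ i, φ i x = 0) → x = 0) {x : B} (hx : ∀ i, 0 ≤ φ i x) : 0 ≤ x := by
  have hsa : IsSelfAdjoint x := by
    refine sub_eq_zero.1 (hφ _ fun i => ?_)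
    rw [map_sub, map_star, (IsSelfAdjoint.of_nonneg (hx i)).star_eq, sub_self]
  refine (CFC.negPart_eq_zero_iff x hsa).1 (hφ _ fun i => ?_)
  have hcont : Continuous (φ i) := map_continuous (φ i)
  rw [CFC.negPart_def, NonUnitalStarAlgHomClass.map_cfcₙ (φ i) _ x (by fun_prop) (by simp)
    hcont hsa (hsa.map (φ i)), ← CFC.negPart_def,
    CFC.negPart_eq_zero_iff _ (hsa.map (φ i))]
  exact hx i

/-- A jointly injective family of `*`-homomorphisms detects the norm, since it detects
the positivity of `c ^ 2 - star x * x`. -/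
lemma norm_le_of_forall_starAlgHom_norm_le (φ : ∀ i, B →⋆ₐ[ℂ] C i)
    (hφ : ∀ x, (∀ i, φ i x = 0) → x = 0) {x : B} {c : ℝ} (hc : 0 ≤ c)
    (hx : ∀ i, ‖φ i x‖ ≤ c) : ‖x‖ ≤ c := by
  have h : 0 ≤ algebraMap ℝ B (c ^ 2) - star x * x := by
    refine nonneg_of_forall_starAlgHom_nonneg φ hφ fun i => ?_
    have h1 : φ i (algebraMap ℝ B (c ^ 2)) = algebraMap ℝ (C i) (c ^ 2) := by
      rw [IsScalarTower.algebraMap_apply ℝ ℂ B, IsScalarTower.algebraMap_apply ℝ ℂ (C i)]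
      exact AlgHomClass.commutes (φ i) _
    rw [map_sub, h1, map_mul, map_star, sub_nonneg]
    refine CStarAlgebra.star_mul_le_algebraMap_norm_sq.trans ?_
    exact algebraMap_mono _ (by have := hx i; gcongr)
  have h2 := (CStarAlgebra.norm_le_iff_le_algebraMap (star x * x) (sq_nonneg c)
    (star_mul_self_nonneg x)).2 (sub_nonneg.1 h)
  rw [CStarRing.norm_star_mul_self, ← sq] at h2
  exact abs_le_of_sq_le_sq' h2 hc |>.2

end JointlyFaithful

/-! ### Matrices of operators -/

section BlockOperators

open ContinuousLinearMap
open scoped InnerProduct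

variable {n : Type*} [Fintype n] {H K : Type*} [NormedAddCommGroup H] [InnerProductSpace ℂ H]
  [CompleteSpace H] [NormedAddCommGroup K] [InnerProductSpace ℂ K] [CompleteSpace K]

/-- The `j`-th coordinate `H^n → H`. Its adjoint is the inclusion of the `j`-th summand. -/
abbrev blockProj (H : Type*) [NormedAddCommGroup H] [InnerProductSpace ℂ H] (j : n) :
    PiLp 2 (fun _ : n => H) →L[ℂ] H :=
  PiLp.proj 2 (fun _ : n => H) j

lemma adjoint_blockProj_apply [DecidableEq n] (j : n) (h : H) :
    ((blockProj (n := n) H j)†) h = WithLp.toLp 2 (Pi.single j h) := by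
  refine ext_inner_left ℂ fun v => ?_
  rw [adjoint_inner_right, PiLp.inner_apply, Finset.sum_eq_single j]
  · simp
  · intro i _ hij; simp [hij]
  · simp

lemma blockProj_comp_adjoint [DecidableEq n] (i j : n) :
    blockProj H i ∘L (blockProj (n := n) H j)† = if i = j then 1 else 0 := by
  ext h
  rw [comp_apply, adjoint_blockProj_apply]
  split_ifs with hij
  · subst hij; simp
  · simp [hij]

lemma sum_adjoint_blockProj_comp :
    ∑ i, (blockProj (n := n) H i)† ∘L blockProj H i = 1 := by
  refine ContinuousLinearMap.ext fun v => ext_inner_left ℂ fun w => ?_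
  simp [sum_apply, inner_sum, adjoint_inner_right, PiLp.inner_apply]

/-- The operator on `H^n` with matrix `T`. -/
def blockOp (T : n → n → H →L[ℂ] H) :
    PiLp 2 (fun _ : n => H) →L[ℂ] PiLp 2 (fun _ : n => H) :=
  ∑ i, ∑ j, (blockProj H i)† ∘L T i j ∘L blockProj H j

lemma blockProj_blockOp (T : n → n → H →L[ℂ] H) (i j : n) :
    blockProj H i ∘L blockOp T ∘L (blockProj H j)† = T i j := by
  classical
  have h : ∀ k l, blockProj H i ∘L ((blockProj H k)† ∘L T k l ∘L blockProj H l) ∘L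
      (blockProj H j)† = if i = k then (if l = j then T k l else 0) else 0 := fun k l => by
    calc _ = (blockProj H i ∘L (blockProj H k)†) ∘L T k l ∘L
        (blockProj H l ∘L (blockProj H j)†) := rfl
      _ = _ := by
        rw [blockProj_comp_adjoint, blockProj_comp_adjoint]
        split_ifs <;> ext <;> simp
  simp [blockOp, finsetSum_comp, comp_finsetSum, h]

/-- Entrywise application of a representation on `H`, as a representation of the matrix algebra
on `H^n`. -/
def matrixRep [DecidableEq n] {A : Type*} [CStarAlgebra A] (π : A →⋆ₐ[ℂ] (H →L[ℂ] H)) :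
    CStarMatrix n n A →⋆ₐ[ℂ] (PiLp 2 (fun _ : n => H) →L[ℂ] PiLp 2 (fun _ : n => H)) :=
  StarAlgHom.mk (AlgHom.ofLinearMap
    { toFun := fun M => blockOp fun i j => π (M i j)
      map_add' := fun M N => by
        simp [blockOp, Finset.sum_add_distrib]
      map_smul' := fun c M => by
        simp [blockOp, Finset.smul_sum] }
    (by
      simp only [LinearMap.coe_mk, AddHom.coe_mk, blockOp]
      rw [← sum_adjoint_blockProj_comp (n := n) (H := H)]
      refine Finset.sum_congr rfl fun i _ => ?_
      rw [Finset.sum_eq_single i]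
      · simp; rfl
      · intro j _ hij; simp [hij.symm]
      · simp)
    (fun M N => by
      simp only [LinearMap.coe_mk, AddHom.coe_mk]
      have h : ∀ i j k l, ((blockProj H i)† ∘L π (M i j) ∘L blockProj H j) *
          ((blockProj H k)† ∘L π (N k l) ∘L blockProj H l) =
          if j = k then (blockProj H i)† ∘L π (M i j * N j l) ∘L blockProj H l else 0 := by
        intro i j k l
        calc _ = (blockProj H i)† ∘L π (M i j) ∘L (blockProj H j ∘L (blockProj H k)†) ∘L
            π (N k l) ∘L blockProj H l := rfl
          _ = _ := by
            rw [blockProj_comp_adjoint]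
            split_ifs with hjk
            · subst hjk; rw [map_mul]; rfl
            · ext; simp
      simp only [blockOp, Finset.sum_mul, Finset.mul_sum, h, CStarMatrix.mul_apply, map_sum,
        finsetSum_comp, comp_finsetSum]
      simp only [Finset.sum_ite_eq', Finset.mem_univ, if_true]
      symm
      rw [Finset.sum_congr rfl fun x _ => Finset.sum_comm, Finset.sum_comm]
      exact Finset.sum_congr rfl fun i _ => Finset.sum_comm))
    (fun M => by
      change blockOp (fun i j => π (star (M j i))) = star (blockOp fun i j => π (M i j))
      simp only [blockOp, star_eq_adjoint, map_sum]
      rw [Finset.sum_comm]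
      refine Finset.sum_congr rfl fun i _ => Finset.sum_congr rfl fun j _ => ?_
      rw [adjoint_comp, adjoint_comp, adjoint_adjoint, map_star,
        star_eq_adjoint, comp_assoc])

lemma matrixRep_apply [DecidableEq n] {A : Type*} [CStarAlgebra A] (π : A →⋆ₐ[ℂ] (H →L[ℂ] H))
    (M : CStarMatrix n n A) : matrixRep π M = blockOp fun i j => π (M i j) := rfl

lemma apply_eq_zero_of_matrixRep [DecidableEq n] {A : Type*} [CStarAlgebra A]
    {π : A →⋆ₐ[ℂ] (H →L[ℂ] H)} {M : CStarMatrix n n A} (h : matrixRep π M = 0) (i j : n) :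
    π (M i j) = 0 := by
  rw [← blockProj_blockOp (fun i j => π (M i j)) i j, ← matrixRep_apply, h]
  simp

/-- The diagonal operator `H^n → K^n` with diagonal entries `V`. -/
def blockDiag (n : Type*) [Fintype n] (V : H →L[ℂ] K) :
    PiLp 2 (fun _ : n => H) →L[ℂ] PiLp 2 (fun _ : n => K) :=
  ∑ i, (blockProj K i)† ∘L V ∘L blockProj H i

omit [CompleteSpace H] in
lemma blockProj_comp_blockDiag (V : H →L[ℂ] K) (i : n) :
    blockProj K i ∘L blockDiag n V = V ∘L blockProj H i := by
  classical
  simp only [blockDiag, comp_finsetSum, ← comp_assoc, blockProj_comp_adjoint]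
  rw [Finset.sum_eq_single i]
  · ext; simp
  · intro j _ hij; ext; simp [hij.symm]
  · simp

lemma adjoint_blockDiag_comp (V : H →L[ℂ] K) (i : n) :
    (blockDiag n V)† ∘L (blockProj K i)† = (blockProj H i)† ∘L V† := by
  rw [← adjoint_comp, blockProj_comp_blockDiag, adjoint_comp]

lemma blockOp_compression (V : H →L[ℂ] K) (T : n → n → K →L[ℂ] K) :
    blockOp (fun i j => V† ∘L T i j ∘L V) = (blockDiag n V)† ∘L blockOp T ∘L blockDiag n V := by
  simp only [blockOp, comp_finsetSum, finsetSum_comp]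
  refine Finset.sum_congr rfl fun i _ => Finset.sum_congr rfl fun j _ => ?_
  calc _ = ((blockProj H i)† ∘L V†) ∘L T i j ∘L (V ∘L blockProj H j) := rfl
    _ = _ := by rw [← adjoint_blockDiag_comp, ← blockProj_comp_blockDiag]; rfl

omit [CompleteSpace H] in
lemma norm_blockDiag_le {V : H →L[ℂ] K} (hV : ‖V‖ ≤ 1) : ‖blockDiag n V‖ ≤ 1 := by
  refine opNorm_le_bound _ zero_le_one fun v => ?_
  rw [one_mul, PiLp.norm_eq_of_L2, PiLp.norm_eq_of_L2]
  refine Real.sqrt_le_sqrt (Finset.sum_le_sum fun i _ => ?_)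
  have h : blockDiag n V v i = V (v i) := congr($(blockProj_comp_blockDiag V i) v)
  rw [h]
  have := V.le_of_opNorm_le hV (v i)
  rw [one_mul] at this
  gcongr

lemma norm_compression_le {V : H →L[ℂ] K} (hV : ‖V‖ ≤ 1) (T : K →L[ℂ] K) :
    ‖V† ∘L T ∘L V‖ ≤ ‖T‖ := by
  calc _ ≤ ‖V†‖ * (‖T‖ * ‖V‖) :=
        (opNorm_comp_le _ _).trans (mul_le_mul_of_nonneg_left (opNorm_comp_le _ _) (norm_nonneg _))
    _ ≤ 1 * (‖T‖ * 1) := by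
      rw [LinearIsometryEquiv.norm_map]
      gcongr
    _ = ‖T‖ := by ring

end BlockOperators

/-! ### Complete positivity and contractivity tested in representations -/

section MatrixEnvelope

open CStarEnvelope

variable {A : Type u} [Ring A] [StarRing A] [Algebra ℂ A] [HasBoundedReps A] [StarModule ℂ A]
  {n : ℕ}

/-- The data of a unital `*`-representation of `A` on a Hilbert space, as an index for the family of
all representations. -/
structure HilbertRep (A : Type u) [Ring A] [StarRing A] [Algebra ℂ A] where
  /-- The Hilbert space. -/
  space : Type u
  [normed : NormedAddCommGroup space]
  [innerProduct : InnerProductSpace ℂ space]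
  [complete : CompleteSpace space]
  /-- The action. -/
  rep : A →⋆ₐ[ℂ] (space →L[ℂ] space)

attribute [instance] HilbertRep.normed HilbertRep.innerProduct HilbertRep.complete

lemma matrixRep_jointly_injective (M : CStarMatrix (Fin n) (Fin n) (CStarEnvelope A))
    (h : ∀ π : HilbertRep A, matrixRep (liftRep π.rep) M = 0) : M = 0 := by
  ext i j
  rw [CStarMatrix.zero_apply, ← norm_le_zero_iff]
  refine norm_le_of_forall_liftRep fun H _ _ _ π => ?_
  rw [apply_eq_zero_of_matrixRep (h ⟨H, π⟩) i j, norm_zero]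

end MatrixEnvelope

/-- A linear map between C*-algebras, the target being an enveloping algebra, is completely
positive and completely contractive if each representation of the target turns it into a
compression of a representation of the source. -/
theorem completelyPositive_and_contractive_of_dilation {A B : Type u}
    [Ring A] [StarRing A] [Algebra ℂ A] [HasBoundedReps A] [StarModule ℂ A]
    [CStarAlgebra B] [PartialOrder B] [StarOrderedRing B]
    (P : B →ₗ[ℂ] CStarEnvelope A)
    (hP : ∀ σ : HilbertRep A, ∃ (K : Type u) (_ : NormedAddCommGroup K)
      (_ : InnerProductSpace ℂ K) (_ : CompleteSpace K) (Φ : B →⋆ₐ[ℂ] (K →L[ℂ] K))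
      (V : σ.space →L[ℂ] K), ‖V‖ ≤ 1 ∧
      ∀ x, CStarEnvelope.liftRep σ.rep (P x) =
        ContinuousLinearMap.adjoint V ∘L Φ x ∘L V) :
    (∀ (n : ℕ) (M : CStarMatrix (Fin n) (Fin n) B), 0 ≤ M → 0 ≤ M.map P) ∧
      IsCompletelyContractive P := by
  have key : ∀ (n : ℕ) (M : CStarMatrix (Fin n) (Fin n) B) (σ : HilbertRep A),
      ∃ (K : Type u) (_ : NormedAddCommGroup K)
      (_ : InnerProductSpace ℂ K) (_ : CompleteSpace K) (Φ : B →⋆ₐ[ℂ] (K →L[ℂ] K))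
      (V : σ.space →L[ℂ] K), ‖V‖ ≤ 1 ∧
      matrixRep (CStarEnvelope.liftRep σ.rep) (M.map P) =
        ContinuousLinearMap.adjoint (blockDiag (Fin n) V) ∘L matrixRep Φ M ∘L
          blockDiag (Fin n) V := by
    intro n M σ
    obtain ⟨K, _, _, _, Φ, V, hV, h⟩ := hP σ
    refine ⟨K, _, _, _, Φ, V, hV, ?_⟩
    rw [matrixRep_apply, matrixRep_apply, ← blockOp_compression]
    congr 1
    funext i j
    exact h _
  refine ⟨fun n M hM => ?_, fun n M => ?_⟩
  · refine nonneg_of_forall_starAlgHom_nonneg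
      (fun σ : HilbertRep A => matrixRep (CStarEnvelope.liftRep σ.rep))
      matrixRep_jointly_injective fun σ => ?_
    obtain ⟨K, _, _, _, Φ, V, -, h⟩ := key n M σ
    rw [h, ContinuousLinearMap.nonneg_iff_isPositive]
    have h0 := (ContinuousLinearMap.nonneg_iff_isPositive _).1 (map_nonneg (matrixRep Φ) hM)
    exact h0.adjoint_conj _
  · refine norm_le_of_forall_starAlgHom_norm_le
      (fun σ : HilbertRep A => matrixRep (CStarEnvelope.liftRep σ.rep))
      matrixRep_jointly_injective (norm_nonneg _) fun σ => ?_
    obtain ⟨K, _, _, _, Φ, V, hV, h⟩ := key n M σ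
    have hD := norm_blockDiag_le (n := Fin n) hV
    have hΦ : ‖matrixRep Φ M‖ ≤ ‖M‖ := NonUnitalStarAlgHom.norm_apply_le (matrixRep Φ) M
    rw [h]
    calc _ ≤ ‖matrixRep Φ M‖ := norm_compression_le hD _
      _ ≤ ‖M‖ := hΦ

/-! ### The Hilbert space `ℓ₂(G) ⊗ H` -/

section EllTwoTensor

open ContinuousLinearMap
open scoped InnerProduct

variable {G : Type u} {H : Type u} [NormedAddCommGroup H] [InnerProductSpace ℂ H]

variable (G H) in
/-- The Hilbert space tensor product `ℓ₂(G) ⊗ H`, realized as the space of square summable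
functions `G → H`. -/
abbrev EllTwoTensor : Type u := lp (fun _ : G => H) 2

/-- The map `f ↦ f ⊗ h`. -/
def tensorRight (h : H) : EllTwo G →L[ℂ] EllTwoTensor G H :=
  lp.mapCLM 2 (fun _ => toSpanSingleton ℂ h) (norm_nonneg h)
    fun _ => (norm_toSpanSingleton h).le

lemma tensorRight_apply (h : H) (f : EllTwo G) (s : G) : tensorRight h f s = f s • h := rfl

open Classical in
lemma tensorRight_delta (h : H) (s : G) : tensorRight h (delta s) = lp.single 2 s h := by
  ext r
  rw [tensorRight_apply, delta, lp.single_apply, lp.single_apply, Pi.single_apply,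
    Pi.single_apply]
  split_ifs <;> simp

lemma hasSum_tensorRight_delta (ξ : EllTwoTensor G H) :
    HasSum (fun s => tensorRight (ξ s) (delta s)) ξ := by
  classical
  convert lp.hasSum_single (p := 2) (by norm_num) ξ using 2 with s
  rw [tensorRight_delta]

lemma ellTwoTensor_clm_ext {F : Type*} [NormedAddCommGroup F] [NormedSpace ℂ F]
    {S T : EllTwoTensor G H →L[ℂ] F}
    (h : ∀ k s, S (tensorRight k (delta s)) = T (tensorRight k (delta s))) : S = T := by
  ext ξ
  have h1 := (hasSum_tensorRight_delta ξ).mapL S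
  have h2 := (hasSum_tensorRight_delta ξ).mapL T
  simp only [h] at h1
  exact h1.unique h2

lemma inner_tensorRight (h k : H) (f g : EllTwo G) :
    inner ℂ (tensorRight h f) (tensorRight k g) = inner ℂ f g * inner ℂ h k := by
  rw [lp.inner_eq_tsum, lp.inner_eq_tsum, ← tsum_mul_right]
  refine tsum_congr fun s => ?_
  rw [tensorRight_apply, tensorRight_apply, inner_smul_left, inner_smul_right,
    RCLike.inner_apply]
  ring

lemma inner_tensorRight_delta (k : H) (s : G) (ξ : EllTwoTensor G H) :
    inner ℂ (tensorRight k (delta s)) ξ = inner ℂ k (ξ s) := by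
  classical
  rw [tensorRight_delta, lp.inner_single_left]

variable (G H) in
/-- The isometry with dense range from the algebraic tensor product. -/
def ellTwoTensorMap : EllTwo G ⊗[ℂ] H →ₗ[ℂ] EllTwoTensor G H :=
  TensorProduct.lift <| LinearMap.mk₂ ℂ (fun f h => tensorRight h f)
    (fun _ _ _ => map_add _ _ _) (fun _ _ _ => map_smul _ _ _)
    (fun f h k => by ext s; simp [tensorRight_apply])
    (fun c f h => by ext s; exact smul_comm _ _ _)

@[simp]
lemma ellTwoTensorMap_tmul (f : EllTwo G) (h : H) :
    ellTwoTensorMap G H (f ⊗ₜ h) = tensorRight h f := rfl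

lemma inner_ellTwoTensorMap (x y : EllTwo G ⊗[ℂ] H) :
    inner ℂ (ellTwoTensorMap G H x) (ellTwoTensorMap G H y) = inner ℂ x y := by
  induction x with
  | zero => simp
  | add x x' hx hx' => rw [map_add, inner_add_left, inner_add_left, hx, hx']
  | tmul f h =>
    induction y with
    | zero => simp
    | add y y' hy hy' => rw [map_add, inner_add_right, inner_add_right, hy, hy']
    | tmul g k => simp [inner_tensorRight]

lemma norm_ellTwoTensorMap (x : EllTwo G ⊗[ℂ] H) : ‖ellTwoTensorMap G H x‖ = ‖x‖ := by
  rw [@norm_eq_sqrt_re_inner ℂ, @norm_eq_sqrt_re_inner ℂ (EllTwo G ⊗[ℂ] H),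
    inner_ellTwoTensorMap]

lemma denseRange_ellTwoTensorMap : DenseRange (ellTwoTensorMap G H) := fun ξ =>
  mem_closure_of_tendsto (hasSum_tensorRight_delta ξ) <| .of_forall fun s =>
    ⟨∑ t ∈ s, delta t ⊗ₜ ξ t, by simp⟩

variable [CompleteSpace H]

/-- The operator `T ⊗ 1` on `ℓ₂(G) ⊗ H`. -/
def ampOp (T : EllTwo G →L[ℂ] EllTwo G) : EllTwoTensor G H →L[ℂ] EllTwoTensor G H :=
  (ellTwoTensorMap G H ∘ₗ (T.rTensor H).toLinearMap).extendOfNorm (ellTwoTensorMap G H)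

@[simp]
lemma ampOp_tensorRight (T : EllTwo G →L[ℂ] EllTwo G) (h : H) (f : EllTwo G) :
    ampOp T (tensorRight h f) = tensorRight h (T f) := by
  rw [← ellTwoTensorMap_tmul, ampOp, LinearMap.extendOfNorm_eq denseRange_ellTwoTensorMap]
  · rfl
  · refine ⟨‖T‖, fun x => ?_⟩
    rw [LinearMap.comp_apply, norm_ellTwoTensorMap, norm_ellTwoTensorMap]
    exact (T.rTensor H).le_of_opNorm_le (norm_rTensor_le _ T) x

lemma ampOp_comp_tensorRight (T : EllTwo G →L[ℂ] EllTwo G) (h : H) :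
    ampOp T ∘L tensorRight h = tensorRight h ∘L T := by
  ext1 f; exact ampOp_tensorRight T h f

lemma adjoint_ampOp (T : EllTwo G →L[ℂ] EllTwo G) :
    (ampOp (H := H) T)† = ampOp (T†) := by
  refine ellTwoTensor_clm_ext fun h s => ?_
  ext t
  refine ext_inner_left ℂ fun k => ?_
  rw [← inner_tensorRight_delta, ← inner_tensorRight_delta, adjoint_inner_right,
    ampOp_tensorRight, ampOp_tensorRight, inner_tensorRight, inner_tensorRight,
    adjoint_inner_right]

variable (G H) in
/-- The representation `T ↦ T ⊗ 1` of `B(ℓ₂(G))` on `ℓ₂(G) ⊗ H`. -/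
def amp : (EllTwo G →L[ℂ] EllTwo G) →⋆ₐ[ℂ] (EllTwoTensor G H →L[ℂ] EllTwoTensor G H) :=
  StarAlgHom.mk (AlgHom.ofLinearMap
    { toFun := ampOp
      map_add' := fun S T => ellTwoTensor_clm_ext fun h s => by simp
      map_smul' := fun c T => ellTwoTensor_clm_ext fun h s => by simp }
    (ellTwoTensor_clm_ext fun h s => by simp)
    (fun S T => ellTwoTensor_clm_ext fun h s => by simp))
    (fun T => (adjoint_ampOp T).symm)

@[simp]
lemma amp_tensorRight (T : EllTwo G →L[ℂ] EllTwo G) (h : H) (f : EllTwo G) :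
    amp G H T (tensorRight h f) = tensorRight h (T f) := ampOp_tensorRight T h f

lemma amp_comp_tensorRight (T : EllTwo G →L[ℂ] EllTwo G) (h : H) :
    amp G H T ∘L tensorRight h = tensorRight h ∘L T := ampOp_comp_tensorRight T h

lemma adjoint_tensorRight_comp_amp (T : EllTwo G →L[ℂ] EllTwo G) (h : H) :
    (tensorRight h)† ∘L amp G H T = T ∘L (tensorRight h)† := by
  rw [← adjoint_adjoint (amp G H T), ← adjoint_comp, ← star_eq_adjoint (amp G H T), ← map_star,
    amp_comp_tensorRight, adjoint_comp, star_eq_adjoint, adjoint_adjoint]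

/-- An operator on `ℓ₂(G) ⊗ H` commutes with `a ⊗ 1` if and only if all its slices, which are
operators on `ℓ₂(G)`, commute with `a`. -/
lemma commute_amp_iff {T : EllTwoTensor G H →L[ℂ] EllTwoTensor G H}
    {a : EllTwo G →L[ℂ] EllTwo G} :
    Commute T (amp G H a) ↔
      ∀ h k : H, Commute ((tensorRight k)† ∘L T ∘L tensorRight h) a := by
  have h1 : ∀ h k : H, ((tensorRight k)† ∘L T ∘L tensorRight h) * a =
      (tensorRight k)† ∘L (T * amp G H a) ∘L tensorRight h := fun h k => by
    calc _ = (tensorRight k)† ∘L T ∘L (tensorRight h ∘L a) := rfl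
      _ = _ := by rw [← amp_comp_tensorRight]; rfl
  have h2 : ∀ h k : H, a * ((tensorRight k)† ∘L T ∘L tensorRight h) =
      (tensorRight k)† ∘L (amp G H a * T) ∘L tensorRight h := fun h k => by
    calc _ = (a ∘L (tensorRight k)†) ∘L T ∘L tensorRight h := rfl
      _ = _ := by rw [← adjoint_tensorRight_comp_amp]; rfl
  refine ⟨fun hT h k => ?_, fun hT => ellTwoTensor_clm_ext fun h s => ?_⟩
  · rw [Commute, SemiconjBy, h1, h2, hT.eq]
  · ext t
    refine ext_inner_left ℂ fun k => ?_
    have h3 := congr(inner ℂ (delta t) ($(hT h k) (delta s)))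
    rw [h1, h2, comp_apply, comp_apply, comp_apply, comp_apply, adjoint_inner_right,
      adjoint_inner_right] at h3
    rwa [← inner_tensorRight_delta, ← inner_tensorRight_delta]

/-- An operator that commutes with `x ⊗ 1` for the generators `x` of a von Neumann algebra commutes
with its whole amplification: the slices of the operator lie in the commutant of the generators. -/
lemma commute_amp_of_mem_vonNeumannGenerated {S : Set (EllTwo G →L[ℂ] EllTwo G)}
    {T : EllTwoTensor G H →L[ℂ] EllTwoTensor G H}
    (hT : ∀ x ∈ S, Commute T (amp G H x) ∧ Commute T (amp G H (star x)))
    {a : EllTwo G →L[ℂ] EllTwo G} (ha : a ∈ (vonNeumannGenerated S).toStarSubalgebra) :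
    Commute T (amp G H a) := by
  refine commute_amp_iff.2 fun h k => ?_
  refine ((StarSubalgebra.mem_centralizer_iff ℂ).1 ha _ ?_).1
  exact (StarSubalgebra.mem_centralizer_iff ℂ).2 fun x hx =>
    ⟨(commute_amp_iff.1 (hT x hx).1 h k).symm.eq, (commute_amp_iff.1 (hT x hx).2 h k).symm.eq⟩

end EllTwoTensor

/-! ### The commuting left and right regular representations -/

section RegularCommutant

open ContinuousLinearMap
open scoped InnerProduct

variable {G : Type u}

lemma ellTwo_clm_ext {F : Type*} [NormedAddCommGroup F] [NormedSpace ℂ F]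
    {S T : EllTwo G →L[ℂ] F} (h : ∀ s, S (delta s) = T (delta s)) : S = T := by
  classical
  refine lp.ext_continuousLinearMap (by norm_num) fun s => ?_
  ext
  convert h s
  all_goals (simp only [comp_apply, lp.singleContinuousLinearMap_apply, delta])

open Classical in
lemma delta_apply (s t : G) : delta s t = if t = s then (1 : ℂ) else 0 := by
  rw [delta, lp.single_apply, Pi.single_apply]

lemma inner_delta (s : G) (f : EllTwo G) : inner ℂ (delta s) f = f s := by
  classical
  rw [delta, lp.inner_single_left]; simp

variable [Group G]

lemma adjoint_leftRegular (t : G) : (leftRegular t)† = leftRegular t⁻¹ := by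
  refine ellTwo_clm_ext fun s => ?_
  ext r
  rw [← inner_delta, ← inner_delta, adjoint_inner_right, leftRegular_delta, leftRegular_delta,
    inner_delta, inner_delta, delta_apply, delta_apply]
  classical exact if_congr eq_inv_mul_iff_mul_eq.symm rfl rfl

/-- The isometry `f ↦ f ∘ (·)⁻¹` of `ℓ₂(G)`. -/
def invOp (G : Type u) [Group G] : EllTwo G →L[ℂ] EllTwo G :=
  LinearIsometry.toContinuousLinearMap
    { toFun := fun f => ⟨fun s => f s⁻¹, memℓp_gen <| by
        have h := (lp.memℓp f).summable (by norm_num)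
        exact (Equiv.inv G).summable_iff.2 h⟩
      map_add' := fun f g => rfl
      map_smul' := fun c f => rfl
      norm_map' := fun f => by
        rw [lp.norm_eq_tsum_rpow (by norm_num), lp.norm_eq_tsum_rpow (by norm_num)]
        congr 1
        exact (Equiv.inv G).tsum_eq fun s => ‖f s‖ ^ (2 : ENNReal).toReal }

lemma invOp_apply (f : EllTwo G) (s : G) : invOp G f s = f s⁻¹ := rfl

lemma invOp_delta (s : G) : invOp G (delta s) = delta s⁻¹ := by
  ext r
  rw [invOp_apply, delta_apply, delta_apply]
  classical exact if_congr inv_eq_iff_eq_inv rfl rfl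

lemma star_invOp : star (invOp G) = invOp G := by
  refine ellTwo_clm_ext fun s => ?_
  ext r
  rw [star_eq_adjoint, ← inner_delta, ← inner_delta, adjoint_inner_right, invOp_delta, invOp_delta,
    inner_delta, inner_delta, delta_apply, delta_apply]
  classical exact if_congr inv_eq_iff_eq_inv rfl rfl

lemma invOp_mul_self : invOp G * invOp G = 1 :=
  ellTwo_clm_ext fun s => by simp [invOp_delta]

/-- The isometry `f ↦ f ∘ (·)⁻¹` as a unitary. -/
def invUnitary (G : Type u) [Group G] : unitary (EllTwo G →L[ℂ] EllTwo G) :=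
  ⟨invOp G, Unitary.mem_iff.2 ⟨by rw [star_invOp, invOp_mul_self],
    by rw [star_invOp, invOp_mul_self]⟩⟩

lemma regularUnitary_one : regularUnitary (1 : G) = 1 :=
  Subtype.ext <| ellTwo_clm_ext fun s => by simp [regularUnitary, leftRegular_delta]

lemma regularUnitary_mul (s t : G) :
    regularUnitary (s * t) = regularUnitary s * regularUnitary t :=
  Subtype.ext <| ellTwo_clm_ext fun r => by
    simp [regularUnitary, leftRegular_delta, mul_assoc]

lemma star_regularUnitary (t : G) : star (regularUnitary t) = regularUnitary t⁻¹ :=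
  Subtype.ext (adjoint_leftRegular t)

/-- Conjugation by the inversion of `G`, which exchanges the left and the right regular
representation. -/
def flipAut (G : Type u) [Group G] :
    (EllTwo G →L[ℂ] EllTwo G) ≃⋆ₐ[ℂ] (EllTwo G →L[ℂ] EllTwo G) :=
  Unitary.conjStarAlgAut ℂ _ (invUnitary G)

lemma flipAut_apply (a : EllTwo G →L[ℂ] EllTwo G) :
    flipAut G a = invOp G * a * invOp G := by
  rw [flipAut, Unitary.conjStarAlgAut_apply]
  change invOp G * a * star (invOp G) = _
  rw [star_invOp]

lemma flipAut_flipAut (a : EllTwo G →L[ℂ] EllTwo G) : flipAut G (flipAut G a) = a := by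
  rw [flipAut_apply, flipAut_apply]
  calc _ = (invOp G * invOp G) * a * (invOp G * invOp G) := by simp only [mul_assoc]
    _ = a := by rw [invOp_mul_self, one_mul, mul_one]

lemma flipAut_leftRegular_apply (t : G) (f : EllTwo G) (s : G) :
    flipAut G (leftRegular t) f s = f (s * t) := by
  rw [flipAut_apply, mul_apply_eq_comp, mul_apply_eq_comp,
    invOp_apply, leftRegular_apply, invOp_apply]
  simp

lemma flipAut_leftRegular_delta (t s : G) :
    flipAut G (leftRegular t) (delta s) = delta (s * t⁻¹) := by
  rw [flipAut_apply, mul_apply_eq_comp, mul_apply_eq_comp,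
    invOp_delta, leftRegular_delta, invOp_delta]
  simp

lemma commute_flipAut_leftRegular (s t : G) :
    Commute (flipAut G (leftRegular s)) (leftRegular t) :=
  ellTwo_clm_ext fun r => by
    simp [flipAut_leftRegular_delta, leftRegular_delta, mul_assoc]

/-- The right regular representation lies in the commutant of `M_G`. -/
lemma commute_flipAut_leftRegular_of_mem (s : G) (a : GroupVN G) :
    Commute (flipAut G (leftRegular s)) a := by
  refine ((StarSubalgebra.mem_centralizer_iff ℂ).1 a.2 _ ?_).1
  refine (StarSubalgebra.mem_centralizer_iff ℂ).2 ?_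
  rintro _ ⟨t, rfl⟩
  refine ⟨(commute_flipAut_leftRegular s t).symm.eq, ?_⟩
  rw [star_eq_adjoint, adjoint_leftRegular]
  exact (commute_flipAut_leftRegular s t⁻¹).symm.eq

lemma commute_flipAut_of_mem (b : GroupVN G) (s : G) :
    Commute (flipAut G b) (leftRegular s) := by
  have h := (commute_flipAut_leftRegular_of_mem s b).symm.map (flipAut G)
  rwa [flipAut_flipAut] at h

/-! ### Fourier coefficients of elements of `M_G` -/

lemma groupCoeff_eq (a : GroupVN G) (t : G) : groupCoeff a t = a.1 (delta 1) t := inner_delta _ _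

/-- The matrix coefficients of `a` are constant along the diagonals. -/
lemma apply_delta_one (a : GroupVN G) (s : G) : a.1 (delta s) 1 = groupCoeff a s⁻¹ := by
  -- `δ_s = ρ(s⁻¹) δ_e`, and `a` commutes with `ρ(s⁻¹)`.
  have h : delta s = flipAut G (leftRegular s⁻¹) (delta 1) := by
    rw [flipAut_leftRegular_delta]; simp
  rw [h, ← mul_apply_eq_comp, ← (commute_flipAut_leftRegular_of_mem s⁻¹ a).eq, mul_apply_eq_comp,
    flipAut_leftRegular_apply, one_mul, groupCoeff_eq]

lemma groupCoeff_add (a b : GroupVN G) (t : G) :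
    groupCoeff (a + b) t = groupCoeff a t + groupCoeff b t := by
  simp [groupCoeff]

lemma groupCoeff_smul (c : ℂ) (a : GroupVN G) (t : G) :
    groupCoeff (c • a) t = c * groupCoeff a t := by
  simp [groupCoeff]

open Classical in
lemma groupCoeff_regularUnitary (s t : G) :
    groupCoeff (regularUnitary s) t = if t = s then 1 else 0 := by
  rw [groupCoeff_eq, regularUnitary, leftRegular_delta, mul_one, delta_apply]

lemma summable_norm_groupCoeff_mul (a b : GroupVN G) :
    Summable fun t => ‖groupCoeff a t * groupCoeff b t‖ := by
  have h := lp.summable_mul (p := 2) (q := 2)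
    (by norm_num; exact Real.HolderConjugate.two_two) (a.1 (delta 1)) (b.1 (delta 1))
  refine h.congr fun t => ?_
  rw [groupCoeff_eq, groupCoeff_eq, norm_mul]

end RegularCommutant

/-! ### Fell's absorption principle -/

section FellAbsorption

open ContinuousLinearMap
open scoped InnerProduct

variable {G : Type u} [Group G] {H : Type u} [NormedAddCommGroup H] [InnerProductSpace ℂ H]
  [CompleteSpace H] (σ : MonoidAlgebra ℂ G →⋆ₐ[ℂ] (H →L[ℂ] H))

lemma norm_rep_single_one_le (t : G) : ‖σ (MonoidAlgebra.single t 1)‖ ≤ 1 := by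
  simpa using norm_rep_single_le σ t 1

lemma rep_single_mul (s t : G) :
    σ (MonoidAlgebra.single s 1) * σ (MonoidAlgebra.single t 1) =
      σ (MonoidAlgebra.single (s * t) 1) := by
  rw [← map_mul, MonoidAlgebra.single_mul_single, one_mul]

lemma rep_single_one : σ (MonoidAlgebra.single 1 1) = 1 := map_one σ

lemma star_rep_single (t : G) :
    star (σ (MonoidAlgebra.single t 1)) = σ (MonoidAlgebra.single t⁻¹ 1) := by
  rw [← map_star, MonoidAlgebra.star_single', star_one]

/-- The operator `ξ ↦ (s ↦ σ(s) ξ(s))` on `ℓ₂(G) ⊗ H`. -/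
def fellOp : EllTwoTensor G H →L[ℂ] EllTwoTensor G H :=
  lp.mapCLM 2 (fun s => σ (MonoidAlgebra.single s 1)) zero_le_one (norm_rep_single_one_le σ)

lemma fellOp_apply (ξ : EllTwoTensor G H) (s : G) :
    fellOp σ ξ s = σ (MonoidAlgebra.single s 1) (ξ s) := rfl

lemma fellOp_tensorRight_delta (h : H) (s : G) :
    fellOp σ (tensorRight h (delta s)) =
      tensorRight (σ (MonoidAlgebra.single s 1) h) (delta s) := by
  classical
  ext r
  rw [fellOp_apply, tensorRight_delta, tensorRight_delta, lp.single_apply, lp.single_apply]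
  by_cases hr : r = s
  · subst hr; simp
  · simp [hr]

lemma star_fellOp_apply (ξ : EllTwoTensor G H) (s : G) :
    star (fellOp σ) ξ s = σ (MonoidAlgebra.single s⁻¹ 1) (ξ s) := by
  refine ext_inner_left ℂ fun k => ?_
  rw [← inner_tensorRight_delta, star_eq_adjoint, adjoint_inner_right, fellOp_tensorRight_delta,
    inner_tensorRight_delta, ← star_rep_single, star_eq_adjoint, adjoint_inner_right]

/-- `fellOp` as a unitary. It intertwines `λ ⊗ 1` and `λ ⊗ σ`. -/
def fellUnitary : unitary (EllTwoTensor G H →L[ℂ] EllTwoTensor G H) :=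
  ⟨fellOp σ, Unitary.mem_iff.2 ⟨by
    ext ξ s
    rw [mul_apply_eq_comp, star_fellOp_apply, fellOp_apply, ← mul_apply_eq_comp, rep_single_mul,
      inv_mul_cancel, rep_single_one]; rfl, by
    ext ξ s
    rw [mul_apply_eq_comp, fellOp_apply, star_fellOp_apply, ← mul_apply_eq_comp, rep_single_mul,
      mul_inv_cancel, rep_single_one]; rfl⟩⟩

/-- The representation `∑ a(t) λ(t) ↦ ∑ a(t) λ(t) ⊗ σ(t)` of `M_G` on `ℓ₂(G) ⊗ H`; it is spatially
equivalent to `a ↦ a ⊗ 1`. -/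
def fellRep : GroupVN G →⋆ₐ[ℂ] (EllTwoTensor G H →L[ℂ] EllTwoTensor G H) :=
  ((Unitary.conjStarAlgAut ℂ _ (fellUnitary σ)).toStarAlgHom.comp (amp G H)).comp
    (StarSubalgebra.subtype _)

lemma fellRep_apply (a : GroupVN G) :
    fellRep σ a = fellOp σ * amp G H a * star (fellOp σ) := rfl

variable (G H) in
/-- The representation `∑ b(t) λ(t) ↦ ∑ b(t) ρ(t) ⊗ 1` of `M_G` on `ℓ₂(G) ⊗ H`, where `ρ` is the
right regular representation. -/
def rightRep : GroupVN G →⋆ₐ[ℂ] (EllTwoTensor G H →L[ℂ] EllTwoTensor G H) :=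
  ((amp G H).comp (flipAut G).toStarAlgHom).comp (StarSubalgebra.subtype _)

lemma rightRep_apply (b : GroupVN G) : rightRep G H b = amp G H (flipAut G b) := rfl

variable (G) in
/-- The operator `1 ⊗ S` on `ℓ₂(G) ⊗ H`. -/
def ampRight (S : H →L[ℂ] H) : EllTwoTensor G H →L[ℂ] EllTwoTensor G H :=
  lp.mapCLM 2 (fun _ => S) (norm_nonneg S) fun _ => le_rfl

omit [Group G] [CompleteSpace H] in
lemma ampRight_tensorRight (S : H →L[ℂ] H) (h : H) (f : EllTwo G) :
    ampRight G S (tensorRight h f) = tensorRight (S h) f := by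
  ext s
  change S (f s • h) = f s • S h
  rw [map_smul]

omit [Group G] in
lemma commute_amp_ampRight (T : EllTwo G →L[ℂ] EllTwo G) (S : H →L[ℂ] H) :
    Commute (amp G H T) (ampRight G S) :=
  ellTwoTensor_clm_ext fun h s => by simp [ampRight_tensorRight]

lemma fellOp_mul_amp_leftRegular (t : G) :
    fellOp σ * amp G H (leftRegular t) =
      ampRight G (σ (MonoidAlgebra.single t 1)) * amp G H (leftRegular t) * fellOp σ :=
  ellTwoTensor_clm_ext fun h s => by
    simp only [mul_apply_eq_comp, amp_tensorRight, leftRegular_delta, fellOp_tensorRight_delta,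
      ampRight_tensorRight]
    rw [← mul_apply_eq_comp, rep_single_mul]

/-- The two representations of `M_G` commute. On the generators `λ(t)` this is clear, since they act
by `λ(t) ⊗ σ(t)`; the general case follows by passing to double commutants. -/
lemma commute_fellRep_rightRep (a b : GroupVN G) : Commute (fellRep σ a) (rightRep G H b) := by
  set U := fellOp σ with hU
  set R := rightRep G H b with hR
  have hU1 : star U * U = 1 := Unitary.star_mul_self_of_mem (fellUnitary σ).2
  have hU2 : U * star U = 1 := Unitary.mul_star_self_of_mem (fellUnitary σ).2
  have hgen : ∀ t, Commute (star U * R * U) (amp G H (leftRegular t)) := fun t => by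
    -- `X = λ(t) ⊗ σ(t)` commutes with `R`, and `U` conjugates `λ(t) ⊗ 1` into it.
    set X := ampRight (H := H) G (σ (MonoidAlgebra.single t 1)) * amp G H (leftRegular t) with hX
    have hRX : R * X = X * R :=
      Commute.mul_right (commute_amp_ampRight _ _) ((commute_flipAut_of_mem b t).map (amp G H))
    have hUX : U * amp G H (leftRegular t) = X * U := fellOp_mul_amp_leftRegular σ t
    have hUX' : star U * X = amp G H (leftRegular t) * star U := by
      calc star U * X = star U * (X * U) * star U := by
            rw [mul_assoc, mul_assoc, hU2, mul_one]
        _ = amp G H (leftRegular t) * star U := by rw [← hUX, ← mul_assoc, hU1, one_mul]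
    calc star U * R * U * amp G H (leftRegular t)
        = star U * (R * X) * U := by rw [mul_assoc, hUX]; simp only [mul_assoc]
      _ = star U * X * R * U := by rw [hRX]; simp only [mul_assoc]
      _ = amp G H (leftRegular t) * (star U * R * U) := by rw [hUX']; simp only [mul_assoc]
  have hcomm : Commute (star U * R * U) (amp G H a) := by
    refine commute_amp_of_mem_vonNeumannGenerated ?_ a.2
    rintro _ ⟨t, rfl⟩
    refine ⟨hgen t, ?_⟩
    rw [star_eq_adjoint (leftRegular t), adjoint_leftRegular]
    exact hgen t⁻¹
  change U * amp G H a * star U * R = R * (U * amp G H a * star U)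
  calc U * amp G H a * star U * R = U * (amp G H a * (star U * R * U)) * star U := by
        simp only [mul_assoc, hU2, mul_one]
    _ = U * star U * R * U * amp G H a * star U := by rw [← hcomm.eq]; simp only [mul_assoc]
    _ = R * (U * amp G H a * star U) := by rw [hU2, one_mul]; simp only [mul_assoc]

/-- The representation of `M_G ⊗ M_G` on `ℓ₂(G) ⊗ H` given by the commuting pair of `fellRep` and
`rightRep`. -/
def pairRep : GroupVN G ⊗[ℂ] GroupVN G →⋆ₐ[ℂ] (EllTwoTensor G H →L[ℂ] EllTwoTensor G H) :=
  StarAlgHom.mk (Algebra.TensorProduct.lift (fellRep σ).toAlgHom (rightRep G H).toAlgHom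
    (commute_fellRep_rightRep σ)) fun x => by
      change Algebra.TensorProduct.lift _ _ _ _ = star (Algebra.TensorProduct.lift _ _ _ _)
      induction x with
      | zero => simp
      | add x y hx hy => rw [star_add, map_add, map_add, star_add, hx, hy]
      | tmul a b =>
        rw [TensorProduct.star_tmul, Algebra.TensorProduct.lift_tmul,
          Algebra.TensorProduct.lift_tmul, star_mul]
        change fellRep σ (star a) * rightRep G H (star b) =
          star (rightRep G H b) * star (fellRep σ a)
        rw [map_star, map_star, ← star_mul, ← star_mul, (commute_fellRep_rightRep σ a b).eq]

lemma pairRep_tmul (a b : GroupVN G) :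
    pairRep σ (a ⊗ₜ b) = fellRep σ a * rightRep G H b :=
  Algebra.TensorProduct.lift_tmul _ _ (commute_fellRep_rightRep σ) _ _

variable (G H) in
/-- The isometry `h ↦ δ_e ⊗ h`. -/
def deltaOne : H →L[ℂ] EllTwoTensor G H :=
  letI := Classical.decEq G
  lp.singleContinuousLinearMap ℂ (fun _ : G => H) 2 1

omit [CompleteSpace H] in
lemma deltaOne_apply (h : H) : deltaOne G H h = tensorRight h (delta 1) := by
  classical
  rw [tensorRight_delta, deltaOne, lp.singleContinuousLinearMap_apply]

omit [CompleteSpace H] in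
lemma norm_deltaOne_le : ‖deltaOne G H‖ ≤ 1 := by
  refine opNorm_le_bound _ zero_le_one fun h => ?_
  classical
  rw [deltaOne_apply, tensorRight_delta, lp.norm_single (by norm_num), one_mul]

lemma adjoint_deltaOne_apply (ξ : EllTwoTensor G H) : ((deltaOne G H)†) ξ = ξ 1 :=
  ext_inner_left ℂ fun k => by
    rw [adjoint_inner_right, deltaOne_apply, inner_tensorRight_delta]

/-- The compression of `pairRep` to `δ_e ⊗ H` is `a ⊗ b ↦ ∑ a(t) b(t) σ(t)`. -/
lemma hasSum_compression_pairRep (a b : GroupVN G) (h : H) :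
    HasSum (fun t => (groupCoeff a t * groupCoeff b t) • σ (MonoidAlgebra.single t 1) h)
      (((deltaOne G H)† ∘L pairRep σ (a ⊗ₜ b) ∘L deltaOne G H) h) := by
  -- `ζ(s) = b(s⁻¹) σ(s⁻¹) h`; expanding `ζ` in the `δ_s ⊗ ζ(s)` gives the series, indexed by `s⁻¹`.
  set ζ : EllTwoTensor G H := star (fellOp σ) (rightRep G H b (deltaOne G H h)) with hζ
  have hζs : ∀ s, ζ s = groupCoeff b s⁻¹ • σ (MonoidAlgebra.single s⁻¹ 1) h := fun s => by
    rw [hζ, star_fellOp_apply, deltaOne_apply, rightRep_apply, amp_tensorRight,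
      tensorRight_apply, map_smul, flipAut_apply, mul_apply_eq_comp, mul_apply_eq_comp,
      invOp_delta, inv_one,
      invOp_apply, groupCoeff_eq]
  have hval : ((deltaOne G H)† ∘L pairRep σ (a ⊗ₜ b) ∘L deltaOne G H) h = amp G H a ζ 1 := by
    rw [comp_apply, comp_apply, adjoint_deltaOne_apply, pairRep_tmul, mul_apply_eq_comp,
      fellRep_apply,
      mul_apply_eq_comp, mul_apply_eq_comp, fellOp_apply, rep_single_one, one_apply_eq_self]
  have hsum := ((hasSum_tensorRight_delta ζ).mapL (amp G H a)).mapL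
    (lp.evalCLM ℂ (fun _ : G => H) 2 1)
  rw [hval, ← (Equiv.inv G).hasSum_iff]
  change HasSum _ (lp.evalCLM ℂ (fun _ : G => H) 2 1 (amp G H a ζ))
  convert hsum using 2 with s
  rw [amp_tensorRight]
  change _ = tensorRight (ζ s) (a.1 (delta s)) 1
  rw [tensorRight_apply, apply_delta_one, hζs, smul_smul]
  rfl

end FellAbsorption

/-! ### The maps `J_G` and `P_G` -/

section DiagonalEmbedding

open CStarEnvelope

variable (G : Type u) [Group G]

/-- The diagonal embedding `t ↦ λ(t) ⊗ λ(t)`, as a homomorphism to the algebraic tensor product. -/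
def diagonalMonoidHom : G →* GroupVN G ⊗[ℂ] GroupVN G where
  toFun t := regularUnitary t ⊗ₜ regularUnitary t
  map_one' := by rw [regularUnitary_one]; rfl
  map_mul' s t := by rw [Algebra.TensorProduct.tmul_mul_tmul, regularUnitary_mul]

/-- The linear extension of the diagonal embedding to the group algebra. -/
def diagonalHom : MonoidAlgebra ℂ G →⋆ₐ[ℂ] GroupVN G ⊗[ℂ] GroupVN G :=
  StarAlgHom.mk (MonoidAlgebra.lift ℂ _ G (diagonalMonoidHom G)) fun x => by
    change MonoidAlgebra.lift ℂ _ G (diagonalMonoidHom G) (star x) =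
      star (MonoidAlgebra.lift ℂ _ G (diagonalMonoidHom G) x)
    induction x using MonoidAlgebra.induction_linear with
    | zero => simp
    | add x y hx hy => rw [star_add, map_add, map_add, star_add, hx, hy]
    | single t c =>
      rw [MonoidAlgebra.star_single', MonoidAlgebra.lift_single, MonoidAlgebra.lift_single,
        star_smul]
      congr 1
      change regularUnitary t⁻¹ ⊗ₜ regularUnitary t⁻¹ =
        star (regularUnitary t ⊗ₜ[ℂ] regularUnitary t)
      rw [TensorProduct.star_tmul, star_regularUnitary]

variable {G}

lemma diagonalHom_single (t : G) :
    diagonalHom G (MonoidAlgebra.single t 1) = regularUnitary t ⊗ₜ regularUnitary t := by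
  change MonoidAlgebra.lift ℂ _ G (diagonalMonoidHom G) _ = _
  rw [MonoidAlgebra.lift_single, one_smul]
  rfl

variable (G) in
/-- The `*`-homomorphism `J_G`. Its existence does not need a faithful representation of the maximal
tensor product: every representation of the algebraic tensor product restricts to one of `ℂ[G]`. -/
def diagonalEmbedding : FullGroupCStar G →⋆ₐ[ℂ] MaxTensor (GroupVN G) (GroupVN G) :=
  lift ((of _).comp (diagonalHom G)) fun x => by
    rw [StarAlgHom.comp_apply, norm_of]
    exact universalNorm_le fun H _ _ _ π => norm_rep_le_universalNorm (π.comp (diagonalHom G)) x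

lemma diagonalEmbedding_universalRep (t : G) :
    diagonalEmbedding G (universalRep t) =
      MaxTensor.tmul (regularUnitary t) (regularUnitary t) := by
  rw [universalRep, diagonalEmbedding, lift_of, StarAlgHom.comp_apply, diagonalHom_single]
  rfl

end DiagonalEmbedding

section DiagonalProjection

open CStarEnvelope
open scoped InnerProduct

variable {G : Type u} [Group G]

lemma norm_universalRep_le (t : G) : ‖universalRep t‖ ≤ 1 := by
  rw [universalRep, norm_of]
  exact universalNorm_le fun H _ _ _ π => norm_rep_single_one_le π t

lemma summable_norm_groupCoeff_smul (a b : GroupVN G) :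
    Summable fun t => ‖(groupCoeff a t * groupCoeff b t) • universalRep t‖ := by
  refine (summable_norm_groupCoeff_mul a b).of_nonneg_of_le (fun t => norm_nonneg _) fun t => ?_
  rw [norm_smul]
  exact mul_le_of_le_one_right (norm_nonneg _) (norm_universalRep_le t)

lemma summable_groupCoeff_smul (a b : GroupVN G) :
    Summable fun t => (groupCoeff a t * groupCoeff b t) • universalRep t :=
  (summable_norm_groupCoeff_smul a b).of_norm

variable (G) in
/-- The map `a ⊗ b ↦ ∑ a(t) b(t) U_G(t)` on the algebraic tensor product. -/
def diagonalSum : GroupVN G ⊗[ℂ] GroupVN G →ₗ[ℂ] FullGroupCStar G :=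
  TensorProduct.lift <| LinearMap.mk₂ ℂ
    (fun a b => ∑' t, (groupCoeff a t * groupCoeff b t) • universalRep t)
    (fun a a' b => by
      rw [← (summable_groupCoeff_smul a b).tsum_add (summable_groupCoeff_smul a' b)]
      simp only [groupCoeff_add, add_mul, add_smul])
    (fun c a b => by
      rw [← (summable_groupCoeff_smul a b).tsum_const_smul]
      simp only [groupCoeff_smul, mul_assoc, smul_smul])
    (fun a b b' => by
      rw [← (summable_groupCoeff_smul a b).tsum_add (summable_groupCoeff_smul a b')]
      simp only [groupCoeff_add, mul_add, add_smul])
    (fun c a b => by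
      rw [← (summable_groupCoeff_smul a b).tsum_const_smul]
      simp only [groupCoeff_smul, mul_left_comm _ c, smul_smul])

lemma hasSum_diagonalSum (a b : GroupVN G) :
    HasSum (fun t => (groupCoeff a t * groupCoeff b t) • universalRep t)
      (diagonalSum G (a ⊗ₜ b)) :=
  (summable_groupCoeff_smul a b).hasSum

/-- In every representation `σ` of `C*(G)`, the map `diagonalSum` is a compression of `pairRep`. -/
lemma liftRep_diagonalSum {H : Type u} [NormedAddCommGroup H] [InnerProductSpace ℂ H]
    [CompleteSpace H] (σ : MonoidAlgebra ℂ G →⋆ₐ[ℂ] (H →L[ℂ] H))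
    (x : GroupVN G ⊗[ℂ] GroupVN G) :
    liftRep σ (diagonalSum G x) = (deltaOne G H)† ∘L pairRep σ x ∘L deltaOne G H := by
  induction x with
  | zero => simp
  | add x y hx hy =>
    rw [map_add, map_add, hx, hy, map_add, ContinuousLinearMap.add_comp,
      ContinuousLinearMap.comp_add]
  | tmul a b =>
    ext h
    refine HasSum.unique ?_ (hasSum_compression_pairRep σ a b h)
    have hcont : Continuous fun y : FullGroupCStar G => liftRep σ y h :=
      (ContinuousLinearMap.apply ℂ H h).continuous.comp (map_continuous (liftRep σ))
    have := (hasSum_diagonalSum a b).map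
      ((ContinuousLinearMap.apply ℂ H h).toLinearMap ∘ₗ (liftRep σ).toAlgHom.toLinearMap) hcont
    refine this.congr_fun ?_
    intro t
    change _ = liftRep σ ((groupCoeff a t * groupCoeff b t) • universalRep t) h
    rw [map_smul, universalRep, liftRep_of]
    rfl

lemma norm_diagonalSum_le (x : GroupVN G ⊗[ℂ] GroupVN G) :
    ‖diagonalSum G x‖ ≤ universalNorm (GroupVN G ⊗[ℂ] GroupVN G) x := by
  refine norm_le_of_forall_liftRep fun H _ _ _ σ => ?_
  rw [liftRep_diagonalSum]
  have hV := norm_deltaOne_le (G := G) (H := H)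
  calc _ ≤ ‖pairRep σ x‖ := norm_compression_le hV _
    _ ≤ _ := norm_rep_le_universalNorm (pairRep σ) x

variable (G) in
/-- The map `P_G` as a bounded linear map. -/
def diagonalProjection : MaxTensor (GroupVN G) (GroupVN G) →L[ℂ] FullGroupCStar G :=
  extendLinear (diagonalSum G)

lemma diagonalProjection_of (x : GroupVN G ⊗[ℂ] GroupVN G) :
    diagonalProjection G (of _ x) = diagonalSum G x :=
  extendLinear_of norm_diagonalSum_le x

lemma liftRep_diagonalProjection {H : Type u} [NormedAddCommGroup H] [InnerProductSpace ℂ H]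
    [CompleteSpace H] (σ : MonoidAlgebra ℂ G →⋆ₐ[ℂ] (H →L[ℂ] H))
    (x : MaxTensor (GroupVN G) (GroupVN G)) :
    liftRep σ (diagonalProjection G x) =
      (deltaOne G H)† ∘L liftRep (pairRep σ) x ∘L deltaOne G H := by
  refine denseRange_of.induction_on (p := fun x : MaxTensor (GroupVN G) (GroupVN G) =>
    liftRep σ (diagonalProjection G x) =
      (deltaOne G H)† ∘L liftRep (pairRep σ) x ∘L deltaOne G H) x ?_ fun x => ?_
  · have h1 := map_continuous (liftRep σ)
    have h2 := map_continuous (liftRep (pairRep σ))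
    exact isClosed_eq (h1.comp (diagonalProjection G).continuous)
      (continuous_const.clm_comp (h2.clm_comp continuous_const))
  · rw [diagonalProjection_of, liftRep_diagonalSum, liftRep_of]

lemma diagonalProjection_diagonalEmbedding (x : FullGroupCStar G) :
    diagonalProjection G (diagonalEmbedding G x) = x := by
  classical
  refine denseRange_of.induction_on (p := fun x : FullGroupCStar G =>
    diagonalProjection G (diagonalEmbedding G x) = x) x ?_ fun x => ?_
  · exact isClosed_eq ((diagonalProjection G).continuous.comp (map_continuous _)) continuous_id
  · induction x using MonoidAlgebra.induction_linear with
    | zero => simp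
    | add x y hx hy => rw [map_add, map_add, map_add, hx, hy]
    | single t c =>
      have h : of _ (MonoidAlgebra.single t c) = c • universalRep t := by
        rw [universalRep, ← map_smul, MonoidAlgebra.smul_single, smul_eq_mul, mul_one]
      rw [h, map_smul, map_smul, diagonalEmbedding_universalRep, MaxTensor.tmul,
        diagonalProjection_of]
      congr 1
      refine (hasSum_diagonalSum _ _).unique ?_
      convert hasSum_ite_eq t (universalRep t) using 2 with s
      rw [groupCoeff_regularUnitary]
      split_ifs with hs
      · simp [hs]
      · simp

end DiagonalProjection

end

theorem theorem2p7 (G : Type u) [Group G] :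
    ∃ (J : FullGroupCStar G →⋆ₐ[ℂ] MaxTensor (GroupVN G) (GroupVN G))
      (P : CompletelyPositiveMap (MaxTensor (GroupVN G) (GroupVN G)) (FullGroupCStar G)),
      Isometry J ∧
      (∀ t : G, J (universalRep t) = MaxTensor.tmul (regularUnitary t) (regularUnitary t)) ∧
      IsCompletelyContractive P.toLinearMap ∧
      (∀ x : FullGroupCStar G, P (J x) = x) ∧
      ∀ a b : GroupVN G,
        Summable (fun t : G => ‖(groupCoeff a t * groupCoeff b t) • universalRep t‖) ∧
        HasSum (fun t : G => (groupCoeff a t * groupCoeff b t) • universalRep t)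
          (P (MaxTensor.tmul a b)) := by
  obtain ⟨hpos, hcontr⟩ := completelyPositive_and_contractive_of_dilation
    (diagonalProjection G).toLinearMap fun σ =>
      ⟨EllTwoTensor G σ.space, inferInstance, inferInstance, inferInstance,
        CStarEnvelope.liftRep (pairRep σ.rep), deltaOne G σ.space, norm_deltaOne_le,
        liftRep_diagonalProjection σ.rep⟩
  refine ⟨diagonalEmbedding G, ⟨(diagonalProjection G).toLinearMap, hpos⟩, ?_,
    diagonalEmbedding_universalRep, hcontr, diagonalProjection_diagonalEmbedding, fun a b =>
      ⟨summable_norm_groupCoeff_smul a b, ?_⟩⟩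
  · -- The left inverse `P_G` makes the `*`-homomorphism `J_G` injective, hence isometric.
    exact NonUnitalStarAlgHom.isometry _
      (Function.LeftInverse.injective diagonalProjection_diagonalEmbedding)
  · change HasSum _ (diagonalProjection G (CStarEnvelope.of _ (a ⊗ₜ b)))
    rw [diagonalProjection_of]
    exact hasSum_diagonalSum a b
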